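/- Let $R$ be a commutative ring and let $A=\bigoplus_{k\in\mathbb{Z}}A_k$ be a commutative graded $R$-algebra with identity such that each $A_k$ is a free $R$-module of finite rank. Let $G=(V,E)$ be a finite simple graph with a fixed linear ordering of its edge set $E$. For $S\subseteq E$ let $k(S)$ be the number of connected components of the spanning subgraph $(V,S)$. The chromatic functor sends $S$ to the graded $R$-module $A^{\otimes k(S)}$, with one tensor factor for each connected component of $(V,S)$. It sends an inclusion $S\subset S\cup\{e\}$ with $e\notin S$ to the map $\mu_{S,e}:A^{\otimes k(S)}\to A^{\otimes k(S\cup\{e\})}$ which multiplies the two tensor factors of the components joined by $e$, if $e$ joins two different components of $(V,S)$, and which is the identity otherwise. The chromatic cochain complex is $$C^i=\bigoplus_{S\subseteq E,\ |S|=i}A^{\otimes k(S)},\qquad \delta^i=\sum_{|S|=i,\ e\in E\setminus S}(-1)^{\#\{f\in S\,:\,f<e\}}\,\mu_{S,e}\qquad(i\in\mathbb{Z}),$$ and the chromatic homology $\mathrm{HCH}_A(G)$ is the cohomology of this complex; its component $\mathrm{HCH}^i_A(G)$ in homological degree $i$ is a graded $R$-module. If $G$ is connected and has $n$ vertices, then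 $\mathrm{HCH}_A(G)$ is supported in homological degrees $0\le i\le n-1$; that is, for every integer $i$ which does not satisfy $0\le i\le n-1$, the graded $R$-module $\mathrm{HCH}^i_A(G)$ is zero. -/

import Mathlib

noncomputable section

namespace ChromaticHomology

open CategoryTheory

/-! ### Multiplying tensor factors along a map of index sets -/

section Tensor

variable {R : Type*} [CommRing R] {A : Type*} [CommRing A] [Algebra R A]
variable {ι κ μ : Type*} [Fintype ι] [Fintype κ] [Fintype μ]
variable [DecidableEq κ] [DecidableEq μ]

/-- The tuple indexed by `κ` whose `k`-th entry is the product of the entries `a i` of the given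
tuple over all `i` with `p i = k`. -/
def fiberProd (p : ι → κ) (a : ι → A) (k : κ) : A :=
  ∏ i : ι with p i = k, a i

theorem fiberProd_update [DecidableEq ι] (p : ι → κ) (a : ι → A) (i : ι) (x : A) :
    fiberProd p (Function.update a i x) =
      Function.update (fiberProd p a) (p i)
        (x * ∏ i' ∈ ({i' | p i' = p i} : Finset ι).erase i, a i') := by
  funext k
  by_cases hk : k = p i
  · subst hk
    have hi : i ∈ ({i' | p i' = p i} : Finset ι) := by simp
    rw [fiberProd, ← Finset.mul_prod_erase _ _ hi]
    simp only [Function.update_self]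
    congr 1
    refine Finset.prod_congr rfl fun i' hi' => ?_
    rw [Function.update_of_ne (Finset.ne_of_mem_erase hi')]
  · rw [Function.update_of_ne hk]
    refine Finset.prod_congr rfl fun i' hi' => ?_
    rw [Function.update_of_ne]
    rintro rfl
    exact hk (Finset.mem_filter.1 hi').2.symm

variable (R A) in
/-- For `p : ι → κ`, the linear map `A^{⊗ ι} → A^{⊗ κ}` which multiplies together those tensor
factors whose indices have the same image under `p`. -/
def fiberMul (p : ι → κ) :
    PiTensorProduct R (fun _ : ι => A) →ₗ[R] PiTensorProduct R (fun _ : κ => A) :=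
  PiTensorProduct.lift
    { toFun := fun a => PiTensorProduct.tprod R (fiberProd p a)
      map_update_add' := by
        intro _ a i x y
        simp only [fiberProd_update, add_mul, MultilinearMap.map_update_add]
      map_update_smul' := by
        intro _ a i c x
        simp only [fiberProd_update, smul_mul_assoc, MultilinearMap.map_update_smul] }

theorem fiberMul_tprod (p : ι → κ) (a : ι → A) :
    fiberMul R A p (PiTensorProduct.tprod R a) = PiTensorProduct.tprod R (fiberProd p a) := by
  rw [fiberMul, PiTensorProduct.lift.tprod]
  rfl

theorem fiberMul_id [DecidableEq ι] (x : PiTensorProduct R (fun _ : ι => A)) :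
    fiberMul R A (fun i : ι => i) x = x := by
  suffices h : fiberMul R A (fun i : ι => i) = LinearMap.id by rw [h]; rfl
  ext a
  simp only [LinearMap.compMultilinearMap_apply, fiberMul_tprod, LinearMap.id_apply]
  congr 1
  funext k
  simp [fiberProd, Finset.filter_eq']

theorem fiberMul_comp (p : ι → κ) (q : κ → μ) (x : PiTensorProduct R (fun _ : ι => A)) :
    fiberMul R A (fun i => q (p i)) x = fiberMul R A q (fiberMul R A p x) := by
  suffices h : fiberMul R A (fun i => q (p i)) = fiberMul R A q ∘ₗ fiberMul R A p by
    rw [h]; rfl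
  ext a
  simp only [LinearMap.compMultilinearMap_apply, fiberMul_tprod, LinearMap.comp_apply]
  congr 1
  funext m
  simp only [fiberProd]
  rw [← Finset.prod_fiberwise_of_maps_to (s := ({i | q (p i) = m} : Finset ι))
    (t := ({k | q k = m} : Finset κ)) (g := p) (by simp)]
  refine Finset.prod_congr rfl fun k hk => Finset.prod_congr ?_ fun _ _ => rfl
  ext i
  simp only [Finset.mem_filter, Finset.mem_univ, true_and] at hk ⊢
  constructor
  · exact fun h => h.2
  · exact fun h => ⟨by rw [h, hk], h⟩

/-- The homogeneous part of degree `j` of `A^{⊗ ι}`, for a graded algebra `A = ⨁ 𝒜 k`: the span of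
the pure tensors of homogeneous elements whose degrees add up to `j`. -/
def tensorDegree (𝒜 : ℤ → Submodule R A) (ι : Type*) [Fintype ι] (j : ℤ) :
    Submodule R (PiTensorProduct R (fun _ : ι => A)) :=
  Submodule.span R
    {t | ∃ (d : ι → ℤ) (a : ι → A), (∑ i, d i) = j ∧ (∀ i, a i ∈ 𝒜 (d i)) ∧
      t = PiTensorProduct.tprod R a}

theorem fiberMul_mem (𝒜 : ℤ → Submodule R A) [GradedAlgebra 𝒜] (p : ι → κ) (j : ℤ)
    (x : PiTensorProduct R (fun _ : ι => A)) (hx : x ∈ tensorDegree 𝒜 ι j) :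
    fiberMul R A p x ∈ tensorDegree 𝒜 κ j := by
  suffices h : tensorDegree 𝒜 ι j ≤ (tensorDegree 𝒜 κ j).comap (fiberMul R A p) from h hx
  refine Submodule.span_le.2 ?_
  rintro _ ⟨d, a, hd, ha, rfl⟩
  refine Submodule.subset_span
    ⟨fun k => ∑ i : ι with p i = k, d i, fiberProd p a, ?_, ?_, fiberMul_tprod p a⟩
  · rw [Finset.sum_fiberwise, hd]
  · exact fun k => SetLike.prod_mem_graded 𝒜 _ _ fun i _ => ha i

/-- The degree `j` part of `fiberMul`. -/
def fiberMulDegree (𝒜 : ℤ → Submodule R A) [GradedAlgebra 𝒜] (p : ι → κ) (j : ℤ) :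
    tensorDegree 𝒜 ι j →ₗ[R] tensorDegree 𝒜 κ j :=
  (fiberMul R A p).restrict (fiberMul_mem 𝒜 p j)

end Tensor

/-! ### The cochain complex of a functor on a Boolean lattice -/

section Boolean

variable {E : Type*} [LinearOrder E]

/-- The balanced colouring of the Boolean lattice of subsets of the ordered set `E`: the colour of
the cover relation from `S` to `S ∪ {e}`, where `e ∉ S`, is `(-1) ^ #{f ∈ S | f < e}`. -/
def coverSign (S : Finset E) (e : E) : ℤ :=
  (-1) ^ ({f ∈ S | f < e} : Finset E).card

variable {R : Type*} [CommRing R]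

/-- The component of degree `i` of the cochain complex of `F`: the direct sum of `F S` over the
subsets `S` with `i` elements. (For finite `E` this product is a finite direct sum.) -/
abbrev BooleanCochain (F : Finset E ⥤ ModuleCat R) (i : ℤ) : Type _ :=
  ∀ S : {S : Finset E // (S.card : ℤ) = i}, F.obj S.1

/-- The differential, summing `coverSign S e • F (S ⋖ S ∪ {e})` over all cover relations with
`#S = i`. The cover relations with target `T` are the `T \ {e} ⋖ T`, for `e ∈ T`. Between the
components of degree `i` and `i'` this is zero unless `i + 1 = i'`. -/
def booleanDifferential (F : Finset E ⥤ ModuleCat R) (i i' : ℤ) :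
    BooleanCochain F i →ₗ[R] BooleanCochain F i' :=
  LinearMap.pi fun T => ∑ e ∈ T.1,
    if h : ((T.1.erase e).card : ℤ) = i then
      coverSign (T.1.erase e) e •
        (F.map (homOfLE (Finset.erase_subset e T.1))).hom ∘ₗ
          LinearMap.proj (R := R) (φ := fun S : {S : Finset E // (S.card : ℤ) = i} => F.obj S.1)
            ⟨T.1.erase e, h⟩
    else 0

theorem booleanDifferential_apply (F : Finset E ⥤ ModuleCat R) (i i' : ℤ)
    (x : BooleanCochain F i) (T : {T : Finset E // (T.card : ℤ) = i'}) :
    booleanDifferential F i i' x T = ∑ e ∈ T.1,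
      if h : ((T.1.erase e).card : ℤ) = i then
        coverSign (T.1.erase e) e •
          (F.map (homOfLE (Finset.erase_subset e T.1))).hom (x ⟨T.1.erase e, h⟩)
      else 0 := by
  rw [booleanDifferential, LinearMap.pi_apply, LinearMap.sum_apply]
  refine Finset.sum_congr rfl fun e _ => ?_
  split_ifs <;> rfl

theorem coverSign_swap_of_lt (T : Finset E) (e f : E) (hf : f ∈ T) (hfe : f < e) :
    coverSign (T.erase e) e * coverSign ((T.erase e).erase f) f =
      -(coverSign (T.erase f) f * coverSign ((T.erase f).erase e) e) := by
  have h1 : ({g ∈ T.erase e | g < e} : Finset E) = {g ∈ T | g < e} := by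
    ext g; simp only [Finset.mem_filter, Finset.mem_erase]
    exact ⟨fun h => ⟨h.1.2, h.2⟩, fun h => ⟨⟨h.2.ne, h.1⟩, h.2⟩⟩
  have h2 : ({g ∈ (T.erase e).erase f | g < f} : Finset E) = {g ∈ T | g < f} := by
    ext g; simp only [Finset.mem_filter, Finset.mem_erase]
    exact ⟨fun h => ⟨h.1.2.2, h.2⟩, fun h => ⟨⟨h.2.ne, (h.2.trans hfe).ne, h.1⟩, h.2⟩⟩
  have h3 : ({g ∈ T.erase f | g < f} : Finset E) = {g ∈ T | g < f} := by
    ext g; simp only [Finset.mem_filter, Finset.mem_erase]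
    exact ⟨fun h => ⟨h.1.2, h.2⟩, fun h => ⟨⟨h.2.ne, h.1⟩, h.2⟩⟩
  have h4 : ({g ∈ (T.erase f).erase e | g < e} : Finset E) = ({g ∈ T | g < e} : Finset E).erase f := by
    ext g; simp only [Finset.mem_filter, Finset.mem_erase]
    exact ⟨fun h => ⟨h.1.2.1, h.1.2.2, h.2⟩, fun h => ⟨⟨h.2.2.ne, h.1, h.2.1⟩, h.2.2⟩⟩
  have hmem : f ∈ ({g ∈ T | g < e} : Finset E) := by simp [hf, hfe]
  have h5 := Finset.card_erase_add_one hmem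
  rw [coverSign, coverSign, coverSign, coverSign, h1, h2, h3, h4, ← h5, pow_succ]
  ring

theorem coverSign_swap (T : Finset E) (e f : E) (he : e ∈ T) (hf : f ∈ T) (hfe : f ≠ e) :
    coverSign (T.erase e) e * coverSign ((T.erase e).erase f) f =
      -(coverSign (T.erase f) f * coverSign ((T.erase f).erase e) e) := by
  rcases lt_or_gt_of_ne hfe with h | h
  · exact coverSign_swap_of_lt T e f hf h
  · rw [coverSign_swap_of_lt T f e he h, neg_neg]

theorem map_eq_of_eq (F : Finset E ⥤ ModuleCat R) {i : ℤ} (x : BooleanCochain F i)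
    {S S' T : Finset E} (hS : S = S') (h : (S.card : ℤ) = i) (h' : (S'.card : ℤ) = i)
    (u : S ⟶ T) (v : S' ⟶ T) :
    (F.map u).hom (x ⟨S, h⟩) = (F.map v).hom (x ⟨S', h'⟩) := by
  subst hS
  rw [Subsingleton.elim u v]

theorem booleanDifferential_comp (F : Finset E ⥤ ModuleCat R) (i i' i'' : ℤ)
    (x : BooleanCochain F i) :
    booleanDifferential F i' i'' (booleanDifferential F i i' x) = 0 := by
  funext T
  by_cases hi : i + 2 = i''
  swap
  · rw [booleanDifferential_apply]
    refine Finset.sum_eq_zero fun e he => ?_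
    split_ifs with h
    · rw [booleanDifferential_apply, Finset.sum_eq_zero, map_zero, smul_zero]
      intro f hf
      rw [dif_neg]
      intro h'
      have h1 := Finset.card_erase_add_one he
      have h2 := Finset.card_erase_add_one hf
      have h3 := T.2
      dsimp only at h' h2
      omega
    · rfl
  by_cases hi' : i + 1 = i'
  swap
  · rw [booleanDifferential_apply]
    refine Finset.sum_eq_zero fun e he => ?_
    rw [dif_neg]
    intro h'
    have h1 := Finset.card_erase_add_one he
    have h3 := T.2
    omega
  have hc2 : ∀ e ∈ T.1, ∀ f ∈ T.1.erase e, (((T.1.erase e).erase f).card : ℤ) = i := by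
    intro e he f hf
    have h1 := Finset.card_erase_add_one he
    have h2 := Finset.card_erase_add_one hf
    have h3 := T.2
    omega
  have hc1 : ∀ e ∈ T.1, ((T.1.erase e).card : ℤ) = i' := by
    intro e he
    have h1 := Finset.card_erase_add_one he
    have h3 := T.2
    omega
  have key : booleanDifferential F i' i'' (booleanDifferential F i i' x) T =
      ∑ p : (Σ e : T.1, ↥(T.1.erase e.1)),
        (coverSign (T.1.erase p.1.1) p.1.1 * coverSign ((T.1.erase p.1.1).erase p.2.1) p.2.1) •
        (F.map (homOfLE ((Finset.erase_subset p.2.1 _).trans (Finset.erase_subset p.1.1 T.1)))).hom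
          (x ⟨(T.1.erase p.1.1).erase p.2.1, hc2 _ p.1.2 _ p.2.2⟩) := by
    rw [booleanDifferential_apply, ← Finset.sum_coe_sort, Fintype.sum_sigma]
    refine Finset.sum_congr rfl fun e _ => ?_
    rw [dif_pos (hc1 _ e.2), booleanDifferential_apply, map_sum, Finset.smul_sum,
      ← Finset.sum_coe_sort]
    refine Finset.sum_congr rfl fun f _ => ?_
    rw [dif_pos (hc2 _ e.2 _ f.2), map_zsmul, smul_smul, ← ModuleCat.comp_apply, ← F.map_comp]
    rfl
  rw [key]
  refine Finset.sum_involution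
    (fun p _ => ⟨⟨p.2.1, Finset.mem_of_mem_erase p.2.2⟩,
      ⟨p.1.1, Finset.mem_erase.2 ⟨(Finset.ne_of_mem_erase p.2.2).symm, p.1.2⟩⟩⟩) ?_ ?_ ?_ ?_
  · rintro ⟨⟨e, he⟩, ⟨f, hf⟩⟩ _
    have hne := Finset.ne_of_mem_erase hf
    have hfT := Finset.mem_of_mem_erase hf
    dsimp only
    rw [coverSign_swap T.1 e f he hfT hne, neg_smul, neg_add_eq_zero]
    congr 1
    exact map_eq_of_eq F x Finset.erase_right_comm _ _ _ _
  · rintro ⟨⟨e, he⟩, ⟨f, hf⟩⟩ _ _ h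
    have h1 := congrArg (fun p : (Σ e : T.1, ↥(T.1.erase e.1)) => p.1.1) h
    exact Finset.ne_of_mem_erase hf h1
  · exact fun _ _ => Finset.mem_univ _
  · exact fun _ _ => rfl

/-- The cochain complex of a functor `F` on the Boolean lattice of subsets of `E`. -/
def booleanComplex (F : Finset E ⥤ ModuleCat R) : CochainComplex (ModuleCat R) ℤ where
  X i := ModuleCat.of R (BooleanCochain F i)
  d i i' := ModuleCat.ofHom (booleanDifferential F i i')
  shape i i' h := by
    refine ModuleCat.hom_ext (LinearMap.ext fun x => funext fun T => ?_)
    refine (booleanDifferential_apply F i i' x T).trans (Finset.sum_eq_zero fun e he => ?_)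
    rw [dif_neg]
    intro h'
    have h1 := Finset.card_erase_add_one he
    have h3 := T.2
    exact h (show i + 1 = i' by omega)
  d_comp_d' i i' i'' _ _ := by
    refine ModuleCat.hom_ext (LinearMap.ext fun x => ?_)
    exact booleanDifferential_comp F i i' i'' x

end Boolean

/-! ### Chromatic homology -/

section Chromatic

variable {V : Type*} [Fintype V] (G : SimpleGraph V)

/-- The spanning subgraph of `G` with the given set of edges. -/
def spanningSubgraph (S : Finset G.edgeSet) : SimpleGraph V :=
  SimpleGraph.fromEdgeSet (Subtype.val '' (S : Set G.edgeSet))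

theorem spanningSubgraph_mono {S T : Finset G.edgeSet} (h : S ⊆ T) :
    spanningSubgraph G S ≤ spanningSubgraph G T :=
  SimpleGraph.fromEdgeSet_mono (Set.image_mono (Finset.coe_subset.2 h))

/-- The set of connected components of the spanning subgraph with edge set `S`. -/
def Component (S : Finset G.edgeSet) : Type _ :=
  (spanningSubgraph G S).ConnectedComponent

instance (S : Finset G.edgeSet) : Finite (Component G S) :=
  inferInstanceAs (Finite (spanningSubgraph G S).ConnectedComponent)

instance (S : Finset G.edgeSet) : Fintype (Component G S) := Fintype.ofFinite _

instance (S : Finset G.edgeSet) : DecidableEq (Component G S) := Classical.decEq _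

/-- For `S ⊆ T`, the component of `T` that contains a given component of `S`. -/
def componentMap {S T : Finset G.edgeSet} (h : S ⊆ T) : Component G S → Component G T :=
  SimpleGraph.ConnectedComponent.map (SimpleGraph.Hom.ofLE (spanningSubgraph_mono G h))

theorem componentMap_refl (S : Finset G.edgeSet) :
    componentMap G (Finset.Subset.refl S) = fun c => c := by
  funext c
  exact SimpleGraph.ConnectedComponent.map_id c

theorem componentMap_trans {S T U : Finset G.edgeSet} (h : S ⊆ T) (h' : T ⊆ U) :
    componentMap G (h.trans h') = fun c => componentMap G h' (componentMap G h c) := by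
  funext c
  exact SimpleGraph.ConnectedComponent.ind (fun _ => rfl) c

variable {R : Type*} [CommRing R] {A : Type*} [CommRing A] [Algebra R A]
variable (𝒜 : ℤ → Submodule R A) [GradedAlgebra 𝒜]

/-- The chromatic functor of `G` and `A = ⨁ 𝒜 k`, in polynomial degree `j`. It sends a set `S` of
edges to the degree `j` part of `A^{⊗ k(S)}`, with one tensor factor for each connected component
of `S`, and an inclusion `S ⊆ T` to the map which multiplies the tensor factors of those components
of `S` that lie in the same component of `T`. So adding an edge which joins two components
multiplies their two factors, and adding an edge which completes a cycle, so that the components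
stay the same, is the identity of the tensor factors. -/
def chromaticFunctor (j : ℤ) : Finset G.edgeSet ⥤ ModuleCat R where
  obj S := ModuleCat.of R (tensorDegree 𝒜 (Component G S) j)
  map {S T} u := ModuleCat.ofHom (fiberMulDegree 𝒜 (componentMap G (leOfHom u)) j)
  map_id S := by
    refine ModuleCat.hom_ext (LinearMap.ext fun x => Subtype.ext ?_)
    change fiberMul R A (componentMap G (Finset.Subset.refl S)) x.1 = x.1
    rw [componentMap_refl, fiberMul_id]
  map_comp {S T U} u v := by
    refine ModuleCat.hom_ext (LinearMap.ext fun x => Subtype.ext ?_)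
    change fiberMul R A (componentMap G ((leOfHom u : S ⊆ T).trans (leOfHom v : T ⊆ U))) x.1 =
      fiberMul R A (componentMap G (leOfHom v)) (fiberMul R A (componentMap G (leOfHom u)) x.1)
    rw [componentMap_trans, fiberMul_comp]

/-- The chromatic homology of `G` with coefficients in `A = ⨁ 𝒜 k`, in homological degree `i`: the
cohomology of the complex of the chromatic functor, as a graded `R`-module, given by the family of
its homogeneous parts of degrees `j : ℤ`. -/
def HCH [LinearOrder G.edgeSet] (i : ℤ) : GradedObject ℤ (ModuleCat R) :=
  fun j => (booleanComplex (chromaticFunctor G 𝒜 j)).homology i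

end Chromatic

end ChromaticHomology

end

/-!
Write `k(S)` for the number of components of `(V, S)`. The argument works with the intervals
`[S, T]` of the Boolean lattice of edge sets. Cochains on `[S, T]` are cochains supported on the
supersets of `S` and considered on the subsets of `T` only, in the original degrees. The claim is
that their cohomology vanishes in every degree `m > #S + k(S) - k(T)`; for `S = ∅` and `T = E` this
is the bound `m > n - 1`. In negative degrees there are no cochains.

The claim is proved by induction on `T \ S`, by deletion and contraction of an edge `e ∈ T \ S`. For
`S = T` the complex lives in degree `#S` only, which the bound on `m` excludes.

* If `e` joins two components of `(V, S)`, then `k(S ∪ {e}) < k(S)`, and the claim for `[S, T]`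
  follows from the claims for `[S, T \ {e}]` (deletion) and `[S ∪ {e}, T]` (contraction). A cocycle
  is first corrected by a coboundary so that it vanishes on the sets without `e`; then it is a
  cocycle on `[S ∪ {e}, T]`.
* If `e` lies inside a component of `(V, S)`, then it lies inside a component of `(V, U)` for every
  `U ⊇ S`, the chromatic functor sends all inclusions `U ⊆ U ∪ {e}` to bijections, and the
  complex of `[S, T]` is the cone of an isomorphism, hence acyclic. In the language of
  contraction, `e` has become a loop.

The induction is `exists_booleanDifferential_eq`, for an arbitrary functor on the Boolean lattice
and an antitone function `k` subject to this dichotomy; for the chromatic functor it is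
`card_component_lt_or_bijective_map`.
-/

noncomputable section

namespace ChromaticHomology

open CategoryTheory

/-! ### Vanishing for functors on a Boolean lattice -/

section Boolean

variable {E : Type*} [LinearOrder E] {R : Type*} [CommRing R]

theorem coverSign_mul_self (S : Finset E) (e : E) : coverSign S e * coverSign S e = 1 := by
  rw [coverSign, ← mul_pow]
  simp

theorem booleanDifferential_apply_eq_zero (F : Finset E ⥤ ModuleCat R) {i i' : ℤ}
    (x : BooleanCochain F i) (T : {T : Finset E // (T.card : ℤ) = i'})
    (hx : ∀ U, U.1 ⊆ T.1 → x U = 0) : booleanDifferential F i i' x T = 0 := by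
  rw [booleanDifferential_apply]
  refine Finset.sum_eq_zero fun e _ => ?_
  split_ifs with h
  · rw [hx _ (Finset.erase_subset e T.1), map_zero, smul_zero]
  · rfl

theorem booleanDifferential_apply_eq_single (F : Finset E ⥤ ModuleCat R) {i i' : ℤ}
    (x : BooleanCochain F i) (T : {T : Finset E // (T.card : ℤ) = i'}) {e : E} (he : e ∈ T.1)
    (h : ((T.1.erase e).card : ℤ) = i) (hx : ∀ U, U.1 ⊆ T.1 → e ∈ U.1 → x U = 0) :
    booleanDifferential F i i' x T = coverSign (T.1.erase e) e •
      (F.map (homOfLE (Finset.erase_subset e T.1))).hom (x ⟨T.1.erase e, h⟩) := by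
  rw [booleanDifferential_apply, Finset.sum_eq_single_of_mem e he, dif_pos h]
  intro f _ hfe
  split_ifs with h'
  · rw [hx _ (Finset.erase_subset f T.1) (Finset.mem_erase.2 ⟨hfe.symm, he⟩), map_zero, smul_zero]
  · rfl

/-- The complex of an interval `[S, T]` is acyclic if adding the element `e ∈ T \ S` to a superset
of `S` induces a bijection: the complex is then the cone of an isomorphism. -/
theorem exists_booleanDifferential_eq_of_bijective (F : Finset E ⥤ ModuleCat R)
    {S T : Finset E} {e : E} (heS : e ∉ S) (heT : e ∈ T)
    (hF : ∀ ⦃U U' : Finset E⦄ (h : U ≤ U'), S ⊆ U → U' = insert e U →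
      Function.Bijective (F.map (homOfLE h)).hom)
    (m : ℤ) (x : BooleanCochain F m) (hxS : ∀ U, ¬ S ⊆ U.1 → x U = 0)
    (hx : ∀ U, U.1 ⊆ T → booleanDifferential F m (m + 1) x U = 0) :
    ∃ y : BooleanCochain F (m - 1), (∀ U, ¬ S ⊆ U.1 → y U = 0) ∧
      ∀ U, U.1 ⊆ T → booleanDifferential F (m - 1) m y U = x U := by
  -- The contracting homotopy: `y U` is the preimage of `± x (U ∪ {e})`.
  have hy : ∀ U : {U : Finset E // (U.card : ℤ) = m - 1}, ∃ v : F.obj U.1,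
      (¬ (e ∉ U.1 ∧ S ⊆ U.1) → v = 0) ∧
      ∀ (W : {W : Finset E // (W.card : ℤ) = m}) (h : U.1 ≤ W.1), e ∉ U.1 → S ⊆ U.1 →
        W.1 = insert e U.1 → (F.map (homOfLE h)).hom v = coverSign U.1 e • x W := by
    intro U
    by_cases hU : e ∉ U.1 ∧ S ⊆ U.1
    · have hc : ((insert e U.1).card : ℤ) = m := by
        rw [Finset.card_insert_of_notMem hU.1]
        have := U.2
        push_cast
        omega
      obtain ⟨v, hv⟩ := (hF (Finset.subset_insert e U.1) hU.2 rfl).2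
        (coverSign U.1 e • x ⟨insert e U.1, hc⟩)
      refine ⟨v, fun h => absurd hU h, ?_⟩
      rintro ⟨W, hW⟩ h _ _ hWU
      dsimp only at hWU
      subst hWU
      exact hv
    · exact ⟨0, fun _ => rfl, fun _ _ h1 h2 => absurd ⟨h1, h2⟩ hU⟩
  choose y hy0 hy1 using hy
  have hd : ∀ U : {U : Finset E // (U.card : ℤ) = m}, e ∈ U.1 →
      booleanDifferential F (m - 1) m y U = x U := by
    intro U heU
    have hc : ((U.1.erase e).card : ℤ) = m - 1 := by
      have h1 := Finset.card_erase_add_one heU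
      have h2 := U.2
      omega
    by_cases hSU : S ⊆ U.1
    · rw [booleanDifferential_apply_eq_single F y U heU hc
          fun W _ heW => hy0 W fun h => h.1 heW,
        hy1 ⟨_, hc⟩ U _ (Finset.notMem_erase e U.1) (Finset.subset_erase.2 ⟨hSU, heS⟩)
          (Finset.insert_erase heU).symm, smul_smul, coverSign_mul_self, one_smul]
    · rw [hxS U hSU, booleanDifferential_apply_eq_zero]
      exact fun W hW => hy0 W fun h => hSU (h.2.trans hW)
  refine ⟨y, fun U hU => hy0 U fun h => hU h.2, fun U hUT => ?_⟩
  by_cases heU : e ∈ U.1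
  · exact hd U heU
  by_cases hSU : S ⊆ U.1
  swap
  · rw [hxS U hSU, booleanDifferential_apply_eq_zero]
    exact fun W hW => hy0 W fun h => hSU (h.2.trans hW)
  -- The cocycle `x - d y` vanishes on the sets that contain `e`, so its value on `U` is sent to
  -- zero by the injective map from `F U` to `F (U ∪ {e})`.
  have hc : ((insert e U.1).card : ℤ) = m + 1 := by
    rw [Finset.card_insert_of_notMem heU]
    have := U.2
    push_cast
    omega
  have her : (insert e U.1).erase e = U.1 := Finset.erase_insert heU
  have hc' : (((insert e U.1).erase e).card : ℤ) = m := by rw [her]; exact U.2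
  have h0 : booleanDifferential F m (m + 1) (x - booleanDifferential F (m - 1) m y)
      ⟨insert e U.1, hc⟩ = 0 := by
    rw [map_sub, booleanDifferential_comp, sub_zero]
    exact hx _ (Finset.insert_subset heT hUT)
  rw [booleanDifferential_apply_eq_single F _ ⟨insert e U.1, hc⟩ (Finset.mem_insert_self e U.1) hc'
    fun W _ heW => by rw [Pi.sub_apply, hd W heW, sub_self]] at h0
  have h1 := congrArg (coverSign ((insert e U.1).erase e) e • ·) h0
  dsimp only at h1
  rw [smul_smul, coverSign_mul_self, one_smul, smul_zero,
    map_eq_of_eq F _ her hc' U.2 _ (homOfLE (Finset.subset_insert e U.1))] at h1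
  have h2 := (hF (Finset.subset_insert e U.1) hSU rfl).1 (h1.trans (map_zero _).symm)
  exact (sub_eq_zero.1 h2).symm

/-- Deletion and contraction: the cohomology of an interval `[S, T]` vanishes if that of the
intervals `[S, T \ {e}]` and `[S ∪ {e}, T]` does. -/
theorem exists_booleanDifferential_eq_of_erase_of_insert (F : Finset E ⥤ ModuleCat R)
    {S T : Finset E} {e : E} {m : ℤ}
    (hdel : ∀ x : BooleanCochain F m, (∀ U, ¬ S ⊆ U.1 → x U = 0) →
      (∀ U, U.1 ⊆ T.erase e → booleanDifferential F m (m + 1) x U = 0) →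
      ∃ y : BooleanCochain F (m - 1), (∀ U, ¬ S ⊆ U.1 → y U = 0) ∧
        ∀ U, U.1 ⊆ T.erase e → booleanDifferential F (m - 1) m y U = x U)
    (hcon : ∀ x : BooleanCochain F m, (∀ U, ¬ insert e S ⊆ U.1 → x U = 0) →
      (∀ U, U.1 ⊆ T → booleanDifferential F m (m + 1) x U = 0) →
      ∃ y : BooleanCochain F (m - 1), (∀ U, ¬ insert e S ⊆ U.1 → y U = 0) ∧
        ∀ U, U.1 ⊆ T → booleanDifferential F (m - 1) m y U = x U)
    (x : BooleanCochain F m) (hxS : ∀ U, ¬ S ⊆ U.1 → x U = 0)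
    (hx : ∀ U, U.1 ⊆ T → booleanDifferential F m (m + 1) x U = 0) :
    ∃ y : BooleanCochain F (m - 1), (∀ U, ¬ S ⊆ U.1 → y U = 0) ∧
      ∀ U, U.1 ⊆ T → booleanDifferential F (m - 1) m y U = x U := by
  obtain ⟨y, hyS, hy⟩ := hdel x hxS fun U hU => hx U (hU.trans (Finset.erase_subset e T))
  let w : BooleanCochain F m := fun U =>
    if e ∈ U.1 then x U - booleanDifferential F (m - 1) m y U else 0
  have hwS : ∀ U, ¬ insert e S ⊆ U.1 → w U = 0 := by
    intro U hU
    by_cases heU : e ∈ U.1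
    · have hSU : ¬ S ⊆ U.1 := fun h => hU (Finset.insert_subset heU h)
      simp only [w, if_pos heU]
      rw [hxS U hSU, booleanDifferential_apply_eq_zero, sub_zero]
      exact fun W hW => hyS W fun h => hSU (h.trans hW)
    · exact if_neg heU
  have hwT : ∀ U, U.1 ⊆ T → w U = x U - booleanDifferential F (m - 1) m y U := by
    intro U hU
    by_cases heU : e ∈ U.1
    · exact if_pos heU
    · rw [hy U (Finset.subset_erase.2 ⟨hU, heU⟩), sub_self]
      exact if_neg heU
  obtain ⟨z, hzS, hz⟩ := hcon w hwS fun U hU => by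
    have h0 : booleanDifferential F m (m + 1)
        (w - (x - booleanDifferential F (m - 1) m y)) U = 0 :=
      booleanDifferential_apply_eq_zero F _ U fun W hW => by
        rw [Pi.sub_apply, hwT W (hW.trans hU), Pi.sub_apply, sub_self]
    rw [map_sub, map_sub, booleanDifferential_comp, sub_zero, Pi.sub_apply, hx U hU,
      sub_zero] at h0
    exact h0
  refine ⟨y + z, fun U hU => ?_, fun U hU => ?_⟩
  · rw [Pi.add_apply, hyS U hU, hzS U fun h => hU ((Finset.subset_insert e S).trans h), add_zero]
  · rw [map_add, Pi.add_apply, hz U hU, hwT U hU, add_sub_cancel]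

/-- Vanishing on intervals. The number `k S - k T` plays the role of the rank of the interval
`[S, T]`: adding an element to `S` decreases `k` or induces bijections above `S`. -/
theorem exists_booleanDifferential_eq (F : Finset E ⥤ ModuleCat R) (k : Finset E → ℕ)
    (hk : Antitone k)
    (hF : ∀ (S : Finset E) (e : E), e ∉ S → k (insert e S) < k S ∨
      ∀ ⦃U U' : Finset E⦄ (h : U ≤ U'), S ⊆ U → U' = insert e U →
        Function.Bijective (F.map (homOfLE h)).hom)
    (m : ℤ) (S T : Finset E) (hm : (S.card : ℤ) + k S - k T < m)
    (x : BooleanCochain F m) (hxS : ∀ U, ¬ S ⊆ U.1 → x U = 0)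
    (hx : ∀ U, U.1 ⊆ T → booleanDifferential F m (m + 1) x U = 0) :
    ∃ y : BooleanCochain F (m - 1), (∀ U, ¬ S ⊆ U.1 → y U = 0) ∧
      ∀ U, U.1 ⊆ T → booleanDifferential F (m - 1) m y U = x U := by
  induction hN : (T \ S).card generalizing S T x with
  | zero =>
    have hTS : T ⊆ S := Finset.sdiff_eq_empty_iff_subset.1 (Finset.card_eq_zero.1 hN)
    refine ⟨0, fun _ _ => rfl, fun U hU => ?_⟩
    rw [map_zero, Pi.zero_apply, hxS U]
    -- A set `U` of `m` elements with `S ⊆ U ⊆ T ⊆ S` would have `m = #S` and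
    -- force `S = T`, against the bound on `m`.
    intro hSU
    have h1 : U.1 = S := (hU.trans hTS).antisymm hSU
    have h2 := U.2
    have h3 : S = T := (hSU.trans hU).antisymm hTS
    subst h3
    rw [h1] at h2
    omega
  | succ N ih =>
    obtain ⟨e, he⟩ : (T \ S).Nonempty := Finset.card_pos.1 (by omega)
    obtain ⟨heT, heS⟩ := Finset.mem_sdiff.1 he
    rcases hF S e heS with hlt | hbij
    · refine exists_booleanDifferential_eq_of_erase_of_insert F (e := e)
        (fun x hxS hx => ih S (T.erase e) ?_ x hxS hx ?_)
        (fun x hxS hx => ih (insert e S) T ?_ x hxS hx ?_) x hxS hx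
      · have := hk (Finset.erase_subset e T)
        omega
      · rw [Finset.erase_sdiff_comm, Finset.card_erase_of_mem he, hN, Nat.add_sub_cancel]
      · rw [Finset.card_insert_of_notMem heS]
        push_cast
        omega
      · rw [Finset.sdiff_insert, Finset.card_erase_of_mem he, hN, Nat.add_sub_cancel]
    · exact exists_booleanDifferential_eq_of_bijective F heS heT hbij m x hxS hx

theorem isZero_booleanComplex_homology (F : Finset E ⥤ ModuleCat R) (i : ℤ)
    (h : ∀ x : BooleanCochain F i, booleanDifferential F i (i + 1) x = 0 →
      ∃ y : BooleanCochain F (i - 1), booleanDifferential F (i - 1) i y = x) :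
    Limits.IsZero ((booleanComplex F).homology i) := by
  rw [← HomologicalComplex.exactAt_iff_isZero_homology,
    HomologicalComplex.exactAt_iff' _ (i - 1) i (i + 1) (by simp) (by simp),
    ShortComplex.moduleCat_exact_iff]
  exact h

end Boolean

/-! ### Components of spanning subgraphs -/

section Chromatic

variable {V : Type*} [Fintype V] (G : SimpleGraph V)

theorem componentMap_surjective {S T : Finset G.edgeSet} (h : S ⊆ T) :
    Function.Surjective (componentMap G h) :=
  SimpleGraph.ConnectedComponent.surjective_map_ofLE _

theorem card_component_antitone : Antitone fun S => Fintype.card (Component G S) :=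
  fun _ _ h => Fintype.card_le_of_surjective _ (componentMap_surjective G h)

theorem card_component_empty : Fintype.card (Component G ∅) = Fintype.card V := by
  symm
  refine Fintype.card_of_bijective
    (f := fun v : V => ((spanningSubgraph G ∅).connectedComponentMk v : Component G ∅)) ⟨?_, ?_⟩
  · intro u v huv
    have h : (spanningSubgraph G ∅).Reachable u v := SimpleGraph.ConnectedComponent.exact huv
    simpa [spanningSubgraph] using h
  · exact fun c => SimpleGraph.ConnectedComponent.ind (fun v => ⟨v, rfl⟩) c

theorem card_component_univ [Fintype G.edgeSet] (hG : G.Connected) :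
    Fintype.card (Component G Finset.univ) = 1 := by
  have h : spanningSubgraph G Finset.univ = G := by simp [spanningSubgraph]
  have hc : (spanningSubgraph G Finset.univ).Connected := h.symm ▸ hG
  have := hc.nonempty
  have := hc.preconnected.subsingleton_connectedComponent
  rw [Fintype.card_eq_one_iff]
  obtain ⟨v⟩ := hc.nonempty
  exact ⟨(spanningSubgraph G Finset.univ).connectedComponentMk v, fun c =>
    Subsingleton.elim (α := (spanningSubgraph G Finset.univ).ConnectedComponent) c _⟩

/-- Adding an edge whose ends are already connected does not merge any components. -/
theorem componentMap_insert_injective_of_reachable [DecidableEq G.edgeSet]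
    {U U' : Finset G.edgeSet} {u v : V} (huv : s(u, v) ∈ G.edgeSet) (h : U ⊆ U') (hU' : U' = insert ⟨s(u, v), huv⟩ U)
    (hr : (spanningSubgraph G U).Reachable u v) :
    Function.Injective (componentMap G h) := by
  intro c c'
  refine SimpleGraph.ConnectedComponent.ind (fun a => ?_) c
  refine SimpleGraph.ConnectedComponent.ind (fun b => ?_) c'
  intro hab
  obtain ⟨w⟩ : (spanningSubgraph G U').Reachable a b := SimpleGraph.ConnectedComponent.exact hab
  refine SimpleGraph.ConnectedComponent.sound ?_
  clear hab c c'
  induction w with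
  | nil => exact SimpleGraph.Reachable.refl _
  | cons hadj _ ih =>
    refine SimpleGraph.Reachable.trans ?_ ih
    subst hU'
    obtain ⟨⟨e, he, heq⟩, hne⟩ := (SimpleGraph.fromEdgeSet_adj _).1 hadj
    rcases Finset.mem_insert.1 (Finset.mem_coe.1 he) with rfl | heU
    · rcases Sym2.eq_iff.1 heq with ⟨rfl, rfl⟩ | ⟨rfl, rfl⟩
      · exact hr
      · exact hr.symm
    · exact SimpleGraph.Adj.reachable
        ((SimpleGraph.fromEdgeSet_adj _).2 ⟨⟨e, Finset.mem_coe.2 heU, heq⟩, hne⟩)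

/-! ### Vanishing of chromatic homology -/

theorem fiberMulDegree_bijective {R : Type*} [CommRing R] {A : Type*} [CommRing A] [Algebra R A]
    (𝒜 : ℤ → Submodule R A) [GradedAlgebra 𝒜] {ι κ : Type*} [Fintype ι] [Fintype κ]
    [DecidableEq ι] [DecidableEq κ] {p : ι → κ} (hp : Function.Bijective p) (j : ℤ) :
    Function.Bijective (fiberMulDegree 𝒜 p j) := by
  obtain ⟨q, hqp, hpq⟩ := Function.bijective_iff_has_inverse.1 hp
  refine Function.bijective_iff_has_inverse.2 ⟨fiberMulDegree 𝒜 q j, fun x => Subtype.ext ?_,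
    fun x => Subtype.ext ?_⟩
  · change fiberMul R A q (fiberMul R A p x.1) = x.1
    rw [← fiberMul_comp]
    simp only [hqp _, fiberMul_id]
  · change fiberMul R A p (fiberMul R A q x.1) = x.1
    rw [← fiberMul_comp]
    simp only [hpq _, fiberMul_id]

variable {R : Type*} [CommRing R] {A : Type*} [CommRing A] [Algebra R A]
variable (𝒜 : ℤ → Submodule R A) [GradedAlgebra 𝒜]

/-- An edge either joins two components of `(V, S)`, or it lies inside a component, and then also
inside a component of `(V, U)` for all `U ⊇ S`. -/
theorem card_component_lt_or_bijective_map [DecidableEq G.edgeSet] (j : ℤ)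
    (S : Finset G.edgeSet) (e : G.edgeSet) :
    Fintype.card (Component G (insert e S)) < Fintype.card (Component G S) ∨
      ∀ ⦃U U' : Finset G.edgeSet⦄ (h : U ≤ U'), S ⊆ U → U' = insert e U →
        Function.Bijective ((chromaticFunctor G 𝒜 j).map (homOfLE h)).hom := by
  by_cases hinj : Function.Injective (componentMap G (Finset.subset_insert e S))
  · right
    intro U U' h hSU hU'
    refine fiberMulDegree_bijective 𝒜 ⟨?_, componentMap_surjective G h⟩ j
    obtain ⟨e, he⟩ := e
    induction e using Sym2.ind with
    | _ u v =>
      refine componentMap_insert_injective_of_reachable G he h hU' ?_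
      have hadj : (spanningSubgraph G (insert ⟨s(u, v), he⟩ S)).Adj u v :=
        (SimpleGraph.fromEdgeSet_adj _).2
          ⟨⟨⟨s(u, v), he⟩, Finset.mem_coe.2 (Finset.mem_insert_self _ S), rfl⟩,
            SimpleGraph.Adj.ne he⟩
      have hS : (spanningSubgraph G S).Reachable u v :=
        SimpleGraph.ConnectedComponent.exact
          (@hinj ((spanningSubgraph G S).connectedComponentMk u)
            ((spanningSubgraph G S).connectedComponentMk v)
            (SimpleGraph.ConnectedComponent.sound hadj.reachable))
      exact hS.mono (spanningSubgraph_mono G hSU)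
  · exact Or.inl (Fintype.card_lt_of_surjective_not_injective _ (componentMap_surjective G _) hinj)

end Chromatic

end ChromaticHomology

end

open ChromaticHomology in
theorem mainTheorem5 {R : Type*} [CommRing R] {A : Type*} [CommRing A] [Algebra R A]
    (𝒜 : ℤ → Submodule R A) [GradedAlgebra 𝒜]
    [∀ k : ℤ, Module.Free R (𝒜 k)] [∀ k : ℤ, Module.Finite R (𝒜 k)]
    {V : Type*} [Fintype V] (G : SimpleGraph V) [LinearOrder G.edgeSet] (hG : G.Connected)
    (i : ℤ) (hi : ¬ (0 ≤ i ∧ i ≤ (Fintype.card V : ℤ) - 1)) (j : ℤ) :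
    CategoryTheory.Limits.IsZero (ChromaticHomology.HCH G 𝒜 i j) := by
  have : Fintype G.edgeSet := Fintype.ofFinite _
  refine isZero_booleanComplex_homology _ i fun x hx => ?_
  by_cases h0 : 0 ≤ i
  · obtain ⟨y, -, hy⟩ := exists_booleanDifferential_eq (chromaticFunctor G 𝒜 j)
      (fun S => Fintype.card (Component G S)) (card_component_antitone G)
      (fun S e _ => card_component_lt_or_bijective_map G 𝒜 j S e) i ∅ Finset.univ
      (by
        rw [card_component_empty, card_component_univ G hG, Finset.card_empty]
        push_cast
        omega)
      x (fun U hU => absurd (Finset.empty_subset _) hU) (fun U _ => by rw [hx]; rfl)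
    exact ⟨y, funext fun U => hy U (Finset.subset_univ _)⟩
  · exact ⟨0, funext fun U => absurd U.2 (by omega)⟩
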